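/- A finite simple graph $G$ is a \emph{circular arc graph} if there is a function $\phi$ assigning to every vertex of $G$ an open arc of a circle such that, for every two distinct vertices $u$ and $w$, $uw$ is an edge of $G$ if and only if $\phi(u)\cap\phi(w)\neq\emptyset$. A path of $G$ is a \emph{longest path} if no path of $G$ has more vertices. \textbf{Theorem.} If $G$ is a connected circular arc graph, then the intersection of all longest paths of $G$ is nonempty, that is, there is a vertex of $G$ that lies on every longest path of $G$. -/

import Mathlib

/-- An open arc of the circle `ℝ / ℤ`: the image of a nonempty bounded open interval of `ℝ`.
Intervals of length more than `1` give the whole circle, which counts as an open arc. -/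
def IsOpenArc (A : Set UnitAddCircle) : Prop :=
  ∃ a b : ℝ, a < b ∧ A = (fun x : ℝ => (x : UnitAddCircle)) '' Set.Ioo a b

/-- A circular arc graph: vertices can be assigned open arcs of a circle (not necessarily pairwise
different) so that distinct vertices are adjacent exactly when their arcs meet. -/
def SimpleGraph.IsCircularArcGraph {V : Type*} (G : SimpleGraph V) : Prop :=
  ∃ φ : V → Set UnitAddCircle, (∀ v, IsOpenArc (φ v)) ∧
    ∀ u w : V, u ≠ w → (G.Adj u w ↔ (φ u ∩ φ w).Nonempty)

/-- A longest path: a path such that no path of the graph, between any two vertices, is longer. -/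
def SimpleGraph.Walk.IsLongestPath {V : Type*} {G : SimpleGraph V} {u v : V}
    (p : G.Walk u v) : Prop :=
  p.IsPath ∧ ∀ (x y : V) (q : G.Walk x y), q.IsPath → q.length ≤ p.length

/-!
Only the maximal arcs matter: if the arc of `v` contains that of `u`, then every longest path
through `u` also visits `v`, since otherwise `v` could be inserted next to `u`. Walking through
all of `G` and passing to maximal arcs gives a sequence `K 0, K 1, …` of vertices, consecutive
ones equal or adjacent, that meets every longest path. If the longest paths have no common vertex,
two of them, `P` and `Q`, are separated in this sequence: for some `b < c`, `P` visits `K b` but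
none of `K (b + 1), …, K c`, and `Q` visits `K c` but none of `K b, …, K (c - 1)`.

A longest path `P` missing a maximal arc `K'` uses no edge between two neighbours of `K'`. Cutting
the circle open at an endpoint of `K'` therefore destroys no edge of `P`, and `P` becomes a path
in an interval graph, where it can be rearranged into a normal path. If `K` is a neighbour of `K'`
on `P`, the part `C` of the normal path before its first neighbour of `K'` consists of vertices
whose arcs lie in that of `K`. So from the rest of `P` one may leave to `K'`, follow the sequence
to the other path `Q` and append the corresponding part `D` of `Q`, at the cost of `C`. As `P` is
longest this gives `|D| < |C|`, and symmetrically `|C| < |D|`.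
-/

namespace CircularArc

variable {V : Type*} {G : SimpleGraph V}

/-- The vertices of a path of `G`, listed in order. The empty list is allowed. -/
structure IsPathList (G : SimpleGraph V) (P : List V) : Prop where
  nodup : P.Nodup
  isChain : P.IsChain G.Adj

theorem isPathList_append {A B : List V} :
    IsPathList G (A ++ B) ↔ IsPathList G A ∧ IsPathList G B ∧ A.Disjoint B ∧
      ∀ a ∈ A.getLast?, ∀ b ∈ B.head?, G.Adj a b := by
  constructor
  · rintro ⟨hnd, hc⟩
    obtain ⟨hA, hB, hAB⟩ := List.isChain_append.1 hc
    exact ⟨⟨hnd.of_append_left, hA⟩, ⟨hnd.of_append_right, hB⟩,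
      List.disjoint_of_nodup_append hnd, hAB⟩
  · rintro ⟨hA, hB, hdisj, hAB⟩
    exact ⟨hA.nodup.append hB.nodup hdisj, List.isChain_append.2 ⟨hA.isChain, hB.isChain, hAB⟩⟩

theorem isPathList_cons {u : V} {P : List V} :
    IsPathList G (u :: P) ↔ u ∉ P ∧ IsPathList G P ∧ ∀ b ∈ P.head?, G.Adj u b := by
  constructor
  · rintro ⟨hnd, hc⟩
    obtain ⟨hadj, hP⟩ := List.isChain_cons.1 hc
    exact ⟨(List.nodup_cons.1 hnd).1, ⟨(List.nodup_cons.1 hnd).2, hP⟩, hadj⟩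
  · rintro ⟨hu, hP, hadj⟩
    exact ⟨List.nodup_cons.2 ⟨hu, hP.nodup⟩, List.isChain_cons.2 ⟨hadj, hP.isChain⟩⟩

theorem IsPathList.reverse {P : List V} (hP : IsPathList G P) : IsPathList G P.reverse :=
  ⟨List.nodup_reverse.2 hP.nodup, List.isChain_reverse.2 (hP.isChain.imp fun _ _ h => h.symm)⟩

theorem IsPathList.exists_adj_of_mem {P : List V} {u : V} (hP : IsPathList G P) (hu : u ∈ P)
    (hne : P ≠ [u]) : ∃ x ∈ P, G.Adj u x := by
  obtain ⟨A, B, rfl⟩ := List.append_of_mem hu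
  obtain ⟨-, huB, -, hAu⟩ := isPathList_append.1 hP
  rcases List.eq_nil_or_concat A with rfl | ⟨A, a, rfl⟩
  · obtain ⟨b, B, rfl⟩ := List.exists_cons_of_ne_nil (show B ≠ [] by simpa using hne)
    exact ⟨b, by simp, (isPathList_cons.1 huB).2.2 b rfl⟩
  · exact ⟨a, by simp, (hAu a (by simp) u rfl).symm⟩

theorem isPathList_support {u v : V} {p : G.Walk u v} (hp : p.IsPath) : IsPathList G p.support :=
  ⟨hp.support_nodup, p.isChain_adj_support⟩

section NormalPath

variable {β : Type*} [LinearOrder β] {key : V → β}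

/-- The ordering of the right endpoints of an interval graph: if `i < j < k` in this order and `i`
is adjacent to `k`, then so is `j`. Ties between keys are allowed. -/
def IsRightEndKey (G : SimpleGraph V) (key : V → β) : Prop :=
  ∀ ⦃i j k⦄, G.Adj i k → key i ≤ key j → key j ≤ key k → j ≠ k → G.Adj j k

theorem IsRightEndKey.adj_of_adj_of_adj (h : IsRightEndKey G key) {u b x z : V} (hub : G.Adj u b)
    (hxz : G.Adj x z) (hxb : key x ≤ key b) (huz : key u ≤ key z) (hbz : b ≠ z) : G.Adj b z := by
  rcases le_total (key z) (key b) with hzb | hbz'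
  · exact (h hub huz hzb hbz.symm).symm
  · exact h hxz hxb hbz' hbz

theorem IsRightEndKey.isPathList_erase (h : IsRightEndKey G key) {A B : List V} {u : V}
    (hP : IsPathList G (A ++ u :: B)) (hu : ∀ v ∈ A ++ u :: B, key u ≤ key v) :
    IsPathList G (A ++ B) := by
  obtain ⟨hA, huB, hdisj, hAu⟩ := isPathList_append.1 hP
  obtain ⟨-, hB, hu_adj⟩ := isPathList_cons.1 huB
  rw [List.disjoint_cons_right] at hdisj
  refine isPathList_append.2 ⟨hA, hB, hdisj.2, fun a ha b hb => ?_⟩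
  have haA := List.mem_of_getLast? ha
  have hbB := List.mem_of_head? hb
  exact h.adj_of_adj_of_adj (hAu a ha u rfl).symm (hu_adj b hb) (hu a (by simp [haA]))
    (hu b (by simp [hbB])) (List.disjoint_iff_ne.1 hdisj.2 a haA b hbB)

theorem IsRightEndKey.isPathList_erase_pair (h : IsRightEndKey G key) {A D : List V} {u x : V}
    (hP : IsPathList G (A ++ u :: x :: D)) (hu : ∀ v ∈ A ++ u :: x :: D, key u ≤ key v)
    (hx : ∀ v ∈ A ++ u :: x :: D, G.Adj u v → key x ≤ key v) : IsPathList G (A ++ D) := by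
  obtain ⟨hA, huxD, hdisj, hAu⟩ := isPathList_append.1 hP
  obtain ⟨-, hD, hx_adj⟩ := isPathList_cons.1 (isPathList_cons.1 huxD).2.1
  rw [List.disjoint_cons_right, List.disjoint_cons_right] at hdisj
  refine isPathList_append.2 ⟨hA, hD, hdisj.2.2, fun a ha d hd => ?_⟩
  have haA := List.mem_of_getLast? ha
  have hdD := List.mem_of_head? hd
  have hua : G.Adj u a := (hAu a ha u rfl).symm
  exact h.adj_of_adj_of_adj hua (hx_adj d hd) (hx a (by simp [haA]) hua) (hu d (by simp [hdD]))
    (List.disjoint_iff_ne.1 hdisj.2.2 a haA d hdD)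

theorem IsRightEndKey.isPathList_rotate (h : IsRightEndKey G key) {B C : List V} {u x : V}
    (hP : IsPathList G (u :: (B ++ x :: C))) (hux : G.Adj u x)
    (hu : ∀ v ∈ u :: (B ++ x :: C), key u ≤ key v)
    (hx : ∀ v ∈ u :: (B ++ x :: C), G.Adj u v → key x ≤ key v) :
    IsPathList G (u :: x :: (B.reverse ++ C)) := by
  obtain ⟨huP, hBxC, hu_adj⟩ := isPathList_cons.1 hP
  obtain ⟨hB, hxC, hdisj, hBx⟩ := isPathList_append.1 hBxC
  obtain ⟨hxC', hC, hx_adj⟩ := isPathList_cons.1 hxC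
  rw [List.disjoint_cons_right] at hdisj
  have hBC : IsPathList G (B.reverse ++ C) := by
    refine isPathList_append.2 ⟨hB.reverse, hC, by simpa using hdisj.2, fun b hb c hc => ?_⟩
    rw [List.getLast?_reverse] at hb
    have hub : G.Adj u b := hu_adj b (by simp [List.head?_append, Option.mem_def.1 hb])
    have hbB := List.mem_of_head? hb
    have hcC := List.mem_of_head? hc
    exact h.adj_of_adj_of_adj hub (hx_adj c hc) (hx b (by simp [hbB]) hub) (hu c (by simp [hcC]))
      (List.disjoint_iff_ne.1 hdisj.2 b hbB c hcC)
  have hx_head : ∀ y ∈ (B.reverse ++ C).head?, G.Adj x y := by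
    rcases List.eq_nil_or_concat B with rfl | ⟨B, b, rfl⟩
    · simpa using hx_adj
    · simpa using (hBx b (by simp) x rfl).symm
  refine isPathList_cons.2 ⟨?_, isPathList_cons.2 ⟨by simp [hdisj.1, hxC'], hBC, hx_head⟩, ?_⟩
  · simpa [or_left_comm] using huP
  · simpa using hux

theorem IsRightEndKey.exists_perm_pair (h : IsRightEndKey G key) {P : List V} {u x : V}
    (hP : IsPathList G P) (huP : u ∈ P) (hxP : x ∈ P) (hux : G.Adj u x)
    (hu : ∀ v ∈ P, key u ≤ key v) (hx : ∀ v ∈ P, G.Adj u v → key x ≤ key v) :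
    ∃ A D, (A ++ u :: x :: D).Perm P ∧ IsPathList G (A ++ u :: x :: D) := by
  wlog hafter : ∃ A B C, P = A ++ u :: (B ++ x :: C) generalizing P
  · obtain ⟨A, B, rfl⟩ := List.append_of_mem huP
    have hxA : x ∈ A := by
      have hxB : x ∉ B := fun hxB => by
        obtain ⟨B, C, rfl⟩ := List.append_of_mem hxB
        exact hafter ⟨A, B, C, rfl⟩
      simpa [hux.ne', hxB] using hxP
    obtain ⟨A, A', rfl⟩ := List.append_of_mem hxA
    obtain ⟨E, D, hperm, hpath⟩ := this hP.reverse (by simp) (by simp)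
      (fun v hv => hu v (List.mem_reverse.1 hv)) (fun v hv => hx v (List.mem_reverse.1 hv))
      ⟨B.reverse, A'.reverse, A.reverse, by simp⟩
    exact ⟨E, D, hperm.trans (List.reverse_perm _), hpath⟩
  obtain ⟨A, B, C, rfl⟩ := hafter
  obtain ⟨hA, huBxC, hdisj, hAu⟩ := isPathList_append.1 hP
  have hrot := h.isPathList_rotate huBxC hux (fun v hv => hu v (List.mem_append_right A hv))
    (fun v hv => hx v (List.mem_append_right A hv))
  have hperm : (u :: x :: (B.reverse ++ C)).Perm (u :: (B ++ x :: C)) :=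
    ((((List.reverse_perm B).append_right C).cons x).trans List.perm_middle.symm).cons u
  exact ⟨A, B.reverse ++ C, hperm.append_left A, isPathList_append.2
    ⟨hA, hrot, fun v hvA hv => hdisj hvA (hperm.mem_iff.1 hv), by simpa using hAu⟩⟩

/-- Every vertex of the path is followed by its neighbour of least key among the vertices not yet
visited. In the literature a normal path also starts at a vertex of least key; here this is asked
for separately. -/
inductive IsNormal (G : SimpleGraph V) (key : V → β) : List V → Prop
  | singleton (u : V) : IsNormal G key [u]
  | cons {u x : V} {P : List V} (adj : G.Adj u x) (least : ∀ v ∈ P, G.Adj u v → key x ≤ key v)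
      (tail : IsNormal G key (x :: P)) : IsNormal G key (u :: x :: P)

theorem IsNormal.isChain {P : List V} (hP : IsNormal G key P) : P.IsChain G.Adj := by
  induction hP with
  | singleton u => exact .singleton u
  | cons adj _ _ ih => exact .cons_cons adj ih

theorem IsNormal.key_le_of_append {A B : List V} {K : V} (hP : IsNormal G key (A ++ K :: B))
    (hhead : ∀ a ∈ A.head?, key a ≤ key K) (hK : ∀ v ∈ A, key v ≤ key K → G.Adj v K) :
    ∀ v ∈ A, key v ≤ key K := by
  induction A with
  | nil => simp
  | cons a A ih =>
    have ha : key a ≤ key K := hhead a rfl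
    refine List.forall_mem_cons.2 ⟨ha, ?_⟩
    have haK : G.Adj a K := hK a (by simp) ha
    cases A with
    | nil => simp
    | cons b A =>
      cases hP with
      | cons _ least tail =>
        refine ih tail ?_ fun v hv => hK v (by simp [hv])
        simpa using least K (by simp) haK

/-- Deleting `u` (and, if some remaining vertex has a smaller key than its least neighbour `x`,
also `x`) leaves a path, which is made normal by induction. -/
theorem IsRightEndKey.exists_isNormal_perm (h : IsRightEndKey G key) {P : List V} {u : V}
    (hP : IsPathList G P) (huP : u ∈ P) (hu : ∀ v ∈ P, key u ≤ key v) :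
    ∃ L, (u :: L).Perm P ∧ IsNormal G key (u :: L) := by
  induction hn : P.length using Nat.strong_induction_on generalizing P u with
  | _ n ih =>
  subst hn
  by_cases hPu : P = [u]
  · exact ⟨[], .of_eq hPu.symm, .singleton u⟩
  obtain ⟨x, ⟨hxP, hux⟩, hx⟩ := Set.exists_min_image {x | x ∈ P ∧ G.Adj u x} key
    (P.finite_toSet.subset fun _ hv => hv.1) (hP.exists_adj_of_mem huP hPu)
  replace hx : ∀ v ∈ P, G.Adj u v → key x ≤ key v := fun v hv huv => hx v ⟨hv, huv⟩
  obtain ⟨A, D, hperm, hpath⟩ := h.exists_perm_pair hP huP hxP hux hu hx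
  simp only [← hperm.mem_iff, ← hperm.length_eq] at hu hx ih
  by_cases hxD : ∀ v ∈ A ++ D, key x ≤ key v
  · have hxxD : ∀ v ∈ A ++ x :: D, key x ≤ key v := fun v hv =>
      (List.mem_cons.1 (List.perm_middle.mem_iff.1 hv)).elim (fun hvx => hvx ▸ le_rfl) (hxD v)
    obtain ⟨L, hL, hnormal⟩ := ih _ (by simp) (h.isPathList_erase hpath hu) (by simp) hxxD rfl
    have hLD : L.Perm (A ++ D) := (hL.trans List.perm_middle).cons_inv
    exact ⟨x :: L, ((hL.cons u).trans List.perm_middle.symm).trans hperm,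
      .cons hux (fun v hv _ => hxD v (hLD.mem_iff.1 hv)) hnormal⟩
  · push Not at hxD
    obtain ⟨v, hvD, hvx⟩ := hxD
    obtain ⟨w, hwD, hw⟩ := Set.exists_min_image {v | v ∈ A ++ D} key (List.finite_toSet _) ⟨v, hvD⟩
    obtain ⟨L, hL, hnormal⟩ := ih _ (by simp) (h.isPathList_erase_pair hpath hu hx) hwD hw rfl
    have hmem : ∀ v ∈ A ++ D, v ∈ A ++ u :: x :: D := by simp +contextual [or_imp]
    have hwx : key w < key x := (hw v hvD).trans_lt hvx
    have hxw : G.Adj x w := (h hux (hu w (hmem w hwD)) hwx.le (ne_of_apply_ne key hwx.ne)).symm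
    have hpermD : (u :: x :: (A ++ D)).Perm (A ++ u :: x :: D) :=
      (List.perm_middle.symm.cons u).trans List.perm_middle.symm
    exact ⟨x :: w :: L, (((hL.cons x).cons u).trans hpermD).trans hperm,
      .cons hux (fun v hv => hx v (hmem v (hL.mem_iff.1 hv)))
        (.cons hxw (fun v hv _ => hw v (hL.mem_iff.1 (by simp [hv]))) hnormal)⟩

end NormalPath

/-- A path with the largest possible number of vertices, as a list of vertices. -/
structure IsLongestList (G : SimpleGraph V) (P : List V) : Prop extends IsPathList G P where
  length_le : ∀ Q : List V, IsPathList G Q → Q.length ≤ P.length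

theorem isLongestList_support {u v : V} {p : G.Walk u v} (hp : p.IsLongestPath) :
    IsLongestList G p.support := by
  refine ⟨isPathList_support hp.1, fun Q hQ => ?_⟩
  rcases eq_or_ne Q [] with rfl | hne
  · simp
  have hsupp := SimpleGraph.Walk.support_ofSupport hne hQ.isChain
  have hlen := hp.2 _ _ (.ofSupport Q hne hQ.isChain)
    ((SimpleGraph.Walk.isPath_def _).2 (hsupp.symm ▸ hQ.nodup))
  rw [← hsupp, SimpleGraph.Walk.length_support, SimpleGraph.Walk.length_support]
  exact Nat.succ_le_succ hlen

namespace IsLongestList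

variable {P : List V}

theorem ne_nil [Nonempty V] (hP : IsLongestList G P) : P ≠ [] := by
  rintro rfl
  simpa using hP.length_le [Classical.arbitrary V] ⟨by simp, by simp⟩

theorem mem_of_adj {A B : List V} {K : V} (hP : IsLongestList G (A ++ B))
    (hA : ∀ a ∈ A.getLast?, G.Adj a K) (hB : ∀ b ∈ B.head?, G.Adj K b) : K ∈ A ++ B := by
  by_contra hK
  obtain ⟨hKA, hKB⟩ : K ∉ A ∧ K ∉ B := by simpa using hK
  obtain ⟨hpA, hpB, hdisj, -⟩ := isPathList_append.1 hP.toIsPathList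
  have hlen := hP.length_le (A ++ K :: B) (isPathList_append.2 ⟨hpA, isPathList_cons.2
    ⟨hKB, hpB, hB⟩, List.disjoint_cons_right.2 ⟨hKA, hdisj⟩, by simpa using hA⟩)
  simp at hlen

theorem isChain_of_notMem {K : V} (hP : IsLongestList G P) (hK : K ∉ P) :
    P.IsChain fun a b => G.Adj a b ∧ ¬(G.Adj a K ∧ G.Adj b K) := by
  rw [List.isChain_iff_forall_rel_of_append_cons_cons]
  rintro a b A B rfl
  refine ⟨(List.isChain_append_cons_cons.1 hP.isChain).2.1, fun ⟨haK, hbK⟩ => hK ?_⟩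
  rw [List.append_cons] at hP ⊢
  exact hP.mem_of_adj (by simpa using haK) (by simpa using hbK.symm)

end IsLongestList

/-- The closed neighbourhood of `u` is contained in that of `v`. -/
def Dominates (G : SimpleGraph V) (v u : V) : Prop :=
  ∀ w, w = u ∨ G.Adj w u → w = v ∨ G.Adj w v

theorem IsLongestList.mem_of_dominates {P : List V} {u v : V} (hP : IsLongestList G P)
    (hu : u ∈ P) (h : Dominates G v u) : v ∈ P := by
  by_contra hv
  have hadj : ∀ w ∈ P, w = u ∨ G.Adj w u → G.Adj w v := fun w hw hwu =>
    (h w hwu).resolve_left fun hwv => hv (hwv ▸ hw)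
  obtain ⟨A, B, rfl⟩ := List.append_of_mem hu
  rw [List.append_cons] at hP hv hadj
  obtain ⟨-, -, -, huB⟩ := isPathList_append.1 hP.toIsPathList
  exact hv (hP.mem_of_adj (by simpa using hadj u (by simp) (.inl rfl)) fun b hb =>
    (hadj b (by simp [List.mem_of_head? hb]) (.inr (huB u (by simp) b hb).symm)).symm)

section ArcModel

variable {l r : V → ℝ} {u v w K : V}

/-- `G` is the intersection graph of the open arcs `(l v, r v)` of the circle `ℝ / ℤ`: the lifts
`(l u, r u)` and `(l w + m, r w + m)` meet for some integer `m`. -/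
structure IsArcModel (G : SimpleGraph V) (l r : V → ℝ) : Prop where
  lt : ∀ v, l v < r v
  adj_iff : ∀ u w, u ≠ w → (G.Adj u w ↔ ∃ m : ℤ, l u < r w + m ∧ l w + m < r u)

theorem exists_isArcModel (h : G.IsCircularArcGraph) : ∃ l r : V → ℝ, IsArcModel G l r := by
  obtain ⟨φ, hφ, hadj⟩ := h
  choose l r hlt hφ using hφ
  refine ⟨l, r, hlt, fun u w huw => (hadj u w huw).trans ?_⟩
  rw [hφ, hφ]
  constructor
  · rintro ⟨_, ⟨x, hx, rfl⟩, y, hy, hyx⟩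
    have hxy : ((x - y : ℝ) : UnitAddCircle) = 0 := by
      rw [AddCircle.coe_sub, sub_eq_zero]
      exact hyx.symm
    obtain ⟨m, hm⟩ := (AddCircle.coe_eq_zero_iff 1).1 hxy
    rw [zsmul_eq_mul, mul_one] at hm
    exact ⟨m, by linarith [hx.1, hy.2], by linarith [hx.2, hy.1]⟩
  · rintro ⟨m, hu, hw⟩
    obtain ⟨x, hlx, hxr⟩ := exists_between (a₁ := max (l u) (l w + m)) (a₂ := min (r u) (r w + m))
      (max_lt (lt_min (hlt u) hu) (lt_min hw (by linarith [hlt w])))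
    rw [max_lt_iff] at hlx
    rw [lt_min_iff] at hxr
    refine ⟨x, ⟨x, ⟨hlx.1, hxr.1⟩, rfl⟩, x - m, ⟨by linarith, by linarith⟩, ?_⟩
    simp

/-- Containment of arcs, witnessed by lifts. -/
def ArcLE (l r : V → ℝ) (u v : V) : Prop :=
  ∃ m : ℤ, l v ≤ l u + m ∧ r u + m ≤ r v

/-- The arc of `u` is maximal with respect to containment. -/
def IsMaxArc (l r : V → ℝ) (u : V) : Prop :=
  ∀ v, ArcLE l r u v → ArcLE l r v u

theorem ArcLE.refl (u : V) : ArcLE l r u u := ⟨0, by simp, by simp⟩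

theorem ArcLE.trans (huv : ArcLE l r u v) (hvw : ArcLE l r v w) : ArcLE l r u w := by
  obtain ⟨m, hlm, hrm⟩ := huv
  obtain ⟨n, hln, hrn⟩ := hvw
  exact ⟨m + n, by push_cast; linarith, by push_cast; linarith⟩

theorem exists_isMaxArc [Finite V] (l r : V → ℝ) (v : V) : ∃ w, ArcLE l r v w ∧ IsMaxArc l r w := by
  obtain ⟨w, hvw, hmax⟩ := Set.exists_max_image {w | ArcLE l r v w} (fun w => r w - l w)
    (Set.toFinite _) ⟨v, ArcLE.refl v⟩
  refine ⟨w, hvw, fun x hwx => ?_⟩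
  have hlen : r x - l x ≤ r w - l w := hmax x (ArcLE.trans hvw hwx)
  obtain ⟨m, hl, hr⟩ := hwx
  exact ⟨-m, by push_cast; linarith, by push_cast; linarith⟩

theorem IsArcModel.reflect (h : IsArcModel G l r) : IsArcModel G (-r) (-l) := by
  refine ⟨fun v => neg_lt_neg (h.lt v), fun u w huw => (h.adj_iff u w huw).trans ?_⟩
  refine (Equiv.neg ℤ).exists_congr fun m => ?_
  simp only [Pi.neg_apply, Equiv.neg_apply, Int.cast_neg, ← neg_add, neg_lt_neg_iff]
  exact and_comm

theorem arcLE_reflect : ArcLE (-r) (-l) u v ↔ ArcLE l r u v := by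
  refine (Equiv.neg ℤ).exists_congr fun m => ?_
  simp only [Pi.neg_apply, Equiv.neg_apply, Int.cast_neg]
  rw [and_comm]
  constructor <;> rintro ⟨h₁, h₂⟩ <;> constructor <;> linarith

theorem isMaxArc_reflect : IsMaxArc (-r) (-l) u ↔ IsMaxArc l r u := by
  simp only [IsMaxArc, arcLE_reflect]

theorem IsArcModel.dominates (h : IsArcModel G l r) (huv : ArcLE l r u v) : Dominates G v u := by
  intro w hwu
  refine or_iff_not_imp_left.2 fun hwv => (h.adj_iff w v hwv).2 ?_
  obtain ⟨m, hl, hr⟩ := huv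
  rcases hwu with rfl | hwu
  · have := h.lt w
    exact ⟨-m, by push_cast; linarith, by push_cast; linarith⟩
  · obtain ⟨n, hln, hrn⟩ := (h.adj_iff w u hwu.ne).1 hwu
    exact ⟨n - m, by push_cast; linarith, by push_cast; linarith⟩

theorem IsArcModel.dominates_of_lt (h : IsArcModel G l r) (hv : l v + 1 < r v) (u : V) :
    Dominates G v u := by
  refine fun w _ => or_iff_not_imp_left.2 fun hwv =>
    ((h.adj_iff v w (Ne.symm hwv)).2 ⟨⌈l v - l w⌉, ?_, ?_⟩).symm
  · linarith [Int.le_ceil (l v - l w), h.lt w]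
  · linarith [Int.ceil_lt_add_one (l v - l w)]

theorem IsArcModel.not_arcLE_of_notMem (h : IsArcModel G l r) {P : List V} (hP : IsLongestList G P)
    (hK : K ∉ P) (hv : v ∈ P) : ¬ArcLE l r v K :=
  fun hvK => hK (hP.mem_of_dominates hv (h.dominates hvK))

/-- The intersection graph of the open intervals `(l v, r v)` of a linear order. -/
def intervalGraph {β : Type*} [LinearOrder β] (l r : V → β) : SimpleGraph V where
  Adj u v := u ≠ v ∧ l u < r v ∧ l v < r u
  symm := ⟨fun _ _ h => ⟨h.1.symm, h.2.2, h.2.1⟩⟩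
  loopless := ⟨fun _ h => h.1 rfl⟩

theorem isRightEndKey_intervalGraph {β : Type*} [LinearOrder β] {l r : V → β}
    (h : ∀ v, l v < r v) : IsRightEndKey (intervalGraph l r) r :=
  fun _ j _ hik hij hjk hne => ⟨hne, (h j).trans_le hjk, hik.2.2.trans_le hij⟩

/-- The least integer `m` for which the lift `(l v + m, r v + m)` ends to the right of `r K`. When
the circle is cut open at the right endpoint of the arc of `K`, this lift represents the arc of
`v`. -/
noncomputable def cutShift (r : V → ℝ) (K v : V) : ℤ := ⌊r K - r v⌋ + 1

theorem lt_add_cutShift (r : V → ℝ) (K v : V) : r K < r v + cutShift r K v := by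
  have := Int.lt_floor_add_one (r K - r v)
  push_cast [cutShift]
  linarith

theorem add_cutShift_lt (hvK : ¬ArcLE l r v K) : l v + cutShift r K v < l K + 1 := by
  by_contra! hle
  refine hvK ⟨⌊r K - r v⌋, ?_, ?_⟩
  · push_cast [cutShift] at hle
    linarith
  · linarith [Int.floor_le (r K - r v)]

theorem IsMaxArc.eq_cutShift (hK : IsMaxArc l r K) (hvK : ¬ArcLE l r v K) {m : ℤ}
    (hr : r K < r v + m) (hl : l v + m < l K + 1) : m = cutShift r K v := by
  have hle : cutShift r K v ≤ m := Int.add_one_le_iff.2 (Int.floor_lt.2 (by linarith))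
  refine (hle.eq_or_lt.resolve_right fun hlt => hvK (hK v ⟨1 - m, ?_, ?_⟩)).symm
  · push_cast
    linarith
  · have hlt' : (cutShift r K v : ℝ) + 1 ≤ m := by exact_mod_cast hlt
    push_cast
    linarith [lt_add_cutShift r K v]

/-- The interval graph of the representing lifts obtained by cutting the circle open at the right
endpoint of the arc of `K`. -/
noncomputable def cutGraph (l r : V → ℝ) (K : V) : SimpleGraph V :=
  intervalGraph (fun v => l v + cutShift r K v) (fun v => r v + cutShift r K v)

theorem IsArcModel.isRightEndKey_cutGraph (h : IsArcModel G l r) (K : V) :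
    IsRightEndKey (cutGraph l r K) (fun v => r v + cutShift r K v) :=
  isRightEndKey_intervalGraph fun v => add_lt_add_left (h.lt v) _

theorem IsArcModel.cutGraph_le (h : IsArcModel G l r) (K : V) : cutGraph l r K ≤ G := by
  rintro v w ⟨hne, hvw, hwv⟩
  exact (h.adj_iff v w hne).2
    ⟨cutShift r K w - cutShift r K v, by push_cast; linarith, by push_cast; linarith⟩

theorem IsArcModel.le_and_le_of_not_adj (h : IsArcModel G l r) (hvK : ¬ArcLE l r v K)
    (hadj : ¬G.Adj v K) : r K ≤ l v + cutShift r K v ∧ r v + cutShift r K v ≤ l K + 1 := by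
  have hne : v ≠ K := fun hv => hvK (hv ▸ .refl v)
  have hl := add_cutShift_lt hvK
  have hr := lt_add_cutShift r K v
  rw [h.adj_iff v K hne] at hadj
  push Not at hadj
  constructor
  · by_contra! hlt
    have := hadj (-cutShift r K v) (by push_cast; linarith)
    push_cast at this
    linarith [h.lt K]
  · have := hadj (1 - cutShift r K v) (by push_cast; linarith [h.lt K])
    push_cast at this
    linarith

theorem IsArcModel.cutGraph_adj (h : IsArcModel G l r) (hK : IsMaxArc l r K)
    (hvK : ¬ArcLE l r v K) (hwK : ¬ArcLE l r w K) (hvw : G.Adj v w) (hadj : ¬G.Adj v K) :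
    (cutGraph l r K).Adj v w := by
  obtain ⟨n, hvn, hwn⟩ := (h.adj_iff v w hvw.ne).1 hvw
  obtain ⟨hl, hr⟩ := h.le_and_le_of_not_adj hvK hadj
  have hshift : n + cutShift r K v = cutShift r K w :=
    hK.eq_cutShift hwK (by push_cast; linarith) (by push_cast; linarith)
  refine ⟨hvw.ne, ?_, ?_⟩ <;> simp only [← hshift] <;> push_cast <;> linarith

/-- Of two consecutive vertices of the path at most one is adjacent to `K`, so every edge of the
path survives the cut. -/
theorem IsLongestList.isPathList_cutGraph {P : List V} (hP : IsLongestList G P)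
    (h : IsArcModel G l r) (hK : IsMaxArc l r K) (hKP : K ∉ P) : IsPathList (cutGraph l r K) P := by
  refine ⟨hP.nodup, ?_⟩
  have hnot {v : V} (hv : v ∈ P) : ¬ArcLE l r v K := h.not_arcLE_of_notMem hP hKP hv
  have hchain := hP.isChain_of_notMem hKP
  rw [List.isChain_iff_forall_rel_of_append_cons_cons] at hchain ⊢
  intro a b A B hAB
  obtain ⟨hab, hnab⟩ := hchain hAB
  have ha := hnot (v := a) (by simp [hAB])
  have hb := hnot (v := b) (by simp [hAB])
  by_cases haK : G.Adj a K
  · exact (h.cutGraph_adj hK hb ha hab.symm fun hbK => hnab ⟨haK, hbK⟩).symm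
  · exact h.cutGraph_adj hK ha hb hab haK

end ArcModel

/-- A rearrangement `T ++ C` of the path `P` such that `T` can be continued to `K'` and `C` consists
of vertices, other than `K`, whose arcs lie in that of `K`. Two longest paths that visit `K` and
avoid `K'`, respectively vice versa, can exchange their parts `C`. -/
structure IsExitSplit (G : SimpleGraph V) (l r : V → ℝ) (P : List V) (K K' : V)
    (T C : List V) : Prop where
  isPathList : IsPathList G (T ++ C)
  perm : (T ++ C).Perm P
  adj : ∀ t ∈ T.getLast?, G.Adj t K'
  ne_and_arcLE : ∀ v ∈ C, v ≠ K ∧ ArcLE l r v K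

section ExitSplit

variable {l r : V → ℝ} {K K' : V} {P : List V}

theorem IsArcModel.exists_perm_cutGraph (h : IsArcModel G l r) (hP : IsLongestList G P)
    (hK : K ∈ P) (hmax : IsMaxArc l r K') (hK' : K' ∉ P) (hl : l K + cutShift r K' K < r K') :
    ∃ A B, (A ++ K :: B).Perm P ∧ IsPathList (cutGraph l r K') (A ++ K :: B) ∧
      ∀ v ∈ A, r v + cutShift r K' v ≤ r K + cutShift r K' K := by
  obtain ⟨u, hu, hmin⟩ := Set.exists_min_image {v | v ∈ P} (fun v => r v + cutShift r K' v)
    P.finite_toSet ⟨K, hK⟩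
  obtain ⟨L, hperm, hnormal⟩ := (h.isRightEndKey_cutGraph K').exists_isNormal_perm
    (hP.isPathList_cutGraph h hmax hK') hu hmin
  obtain ⟨A, B, hAB⟩ := List.append_of_mem (hperm.mem_iff.2 hK)
  have hhead : ∀ a ∈ A.head?, a = u := by
    cases A <;> simp_all
  rw [hAB] at hperm hnormal
  have hnodup := hperm.symm.nodup hP.nodup
  have hKA : K ∉ A := fun hKA => List.disjoint_of_nodup_append hnodup hKA (by simp)
  exact ⟨A, B, hperm, ⟨hnodup, hnormal.isChain⟩, hnormal.key_le_of_append
    (fun a ha => hhead a ha ▸ hmin K hK) fun v hv hvK => ⟨ne_of_mem_of_not_mem hv hKA,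
      (add_lt_add_left (h.lt v) _).trans_le hvK, hl.trans (lt_add_cutShift r K' v)⟩⟩

/-- The circle is cut at the right endpoint of `K'`. In a normal path, all vertices preceding `K`
end before `K`, and those among them that are not adjacent to `K'` also start after `K`. -/
theorem IsArcModel.exists_isExitSplit_of_overlap (h : IsArcModel G l r) (hP : IsLongestList G P)
    (hK : K ∈ P) (hmax : IsMaxArc l r K') (hK' : K' ∉ P) {j : ℤ} (hr : r K' < r K + j)
    (hl : l K + j < r K') : ∃ T C, IsExitSplit G l r P K K' T C := by
  have hnot {v : V} (hv : v ∈ P) : ¬ArcLE l r v K' := h.not_arcLE_of_notMem hP hK' hv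
  have hshort : r K' ≤ l K' + 1 := by
    by_contra! hlong
    exact hK' (hP.mem_of_dominates hK (h.dominates_of_lt hlong K))
  obtain rfl : j = cutShift r K' K := hmax.eq_cutShift (hnot hK) hr (hl.trans_le hshort)
  have hadj : G.Adj K K' := by
    by_contra hadj
    exact hl.not_ge (h.le_and_le_of_not_adj (hnot hK) hadj).1
  obtain ⟨A, B, hperm, hpath, hA⟩ := h.exists_perm_cutGraph hP hK hmax hK' hl
  classical
  obtain ⟨C, T, rfl, hC, hT⟩ : ∃ C T, A = C ++ T ∧ (∀ v ∈ C, ¬G.Adj v K') ∧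
      ∀ t ∈ T.head?, G.Adj t K' :=
    ⟨A.takeWhile (¬G.Adj · K'), A.dropWhile (¬G.Adj · K'), List.takeWhile_append_dropWhile.symm,
      fun v hv => by simpa using List.mem_takeWhile_imp hv, fun t ht => by
        have := List.head?_dropWhile_not (¬G.Adj · K') A
        rw [Option.mem_def.1 ht] at this
        simpa using this⟩
  have hpathG : IsPathList G (C ++ (T ++ K :: B)) := by
    rw [← List.append_assoc]
    exact ⟨hpath.nodup, hpath.isChain.imp (h.cutGraph_le K')⟩
  rw [List.append_assoc] at hperm
  refine ⟨(T ++ K :: B).reverse, C.reverse, ?_, ?_, ?_, ?_⟩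
  · simpa only [← List.reverse_append] using hpathG.reverse
  · simpa only [← List.reverse_append] using (List.reverse_perm _).trans hperm
  · rw [List.getLast?_reverse]
    cases T with
    | nil => simpa using hadj
    | cons t T => simpa using hT
  · intro v hv
    rw [List.mem_reverse] at hv
    refine ⟨fun hvK => hC v hv (hvK ▸ hadj), cutShift r K' v - cutShift r K' K, ?_, ?_⟩
    · have := (h.le_and_le_of_not_adj (hnot (hperm.mem_iff.1 (by simp [hv]))) (hC v hv)).1
      push_cast
      linarith
    · have := hA v (by simp [hv])
      push_cast
      linarith

theorem IsArcModel.exists_isExitSplit (h : IsArcModel G l r) (hP : IsLongestList G P)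
    (hK : K ∈ P) (hmax : IsMaxArc l r K') (hK' : K' ∉ P) (hadj : G.Adj K K') :
    ∃ T C, IsExitSplit G l r P K K' T C := by
  obtain ⟨m, hm₁, hm₂⟩ := (h.adj_iff K' K hadj.ne').1 hadj.symm
  rcases lt_or_ge (r K') (r K + m) with hr | hr
  · exact h.exists_isExitSplit_of_overlap hP hK hmax hK' hr hm₂
  rcases lt_or_ge (l K + m) (l K') with hl | hl
  · obtain ⟨T, C, hTC⟩ := h.reflect.exists_isExitSplit_of_overlap hP hK (isMaxArc_reflect.2 hmax)
      hK' (j := -m) (by simp only [Pi.neg_apply]; push_cast; linarith)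
      (by simp only [Pi.neg_apply]; push_cast; linarith)
    exact ⟨T, C, hTC.isPathList, hTC.perm, hTC.adj, fun v hv =>
      (hTC.ne_and_arcLE v hv).imp_right arcLE_reflect.1⟩
  · exact absurd ⟨m, hl, hr⟩ (h.not_arcLE_of_notMem hP hK' hK)

theorem IsExitSplit.length_lt {Q T C U D : List V} {k k' : V} (hT : IsExitSplit G l r P K K' T C)
    (hU : IsExitSplit G l r Q k k' U D) (h : IsArcModel G l r) (hP : IsLongestList G P)
    {w : G.Walk K' k} (hw : w.IsPath) (hwP : ∀ v ∈ w.support, v ∉ P)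
    (hwQ : ∀ v ∈ w.support, v ≠ k → v ∉ Q) : D.length < C.length := by
  have hadj : ∀ v ∈ D, G.Adj k v := fun v hv =>
    have ⟨hvk, hle⟩ := hU.ne_and_arcLE v hv
    ((h.dominates hle v (.inl rfl)).resolve_left hvk).symm
  have hTP : ∀ v ∈ T, v ∈ P := fun v hv => hT.perm.mem_iff.1 (List.mem_append_left C hv)
  have hwD : w.support.Disjoint D := fun v hv hvD =>
    hwQ v hv (hU.ne_and_arcLE v hvD).1 (hU.perm.mem_iff.1 (List.mem_append_right U hvD))
  have hTD : T.Disjoint D := fun v hv hvD =>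
    h.not_arcLE_of_notMem hP (hwP k w.end_mem_support) (hTP v hv) (hU.ne_and_arcLE v hvD).2
  have hpath : IsPathList G (T ++ (w.support ++ D)) := by
    refine isPathList_append.2 ⟨(isPathList_append.1 hT.isPathList).1, isPathList_append.2
      ⟨isPathList_support hw, (isPathList_append.1 hU.isPathList).2.1, hwD, ?_⟩, ?_, ?_⟩
    · simp only [List.getLast?_eq_some_getLast w.support_ne_nil, w.getLast_support]
      simpa using fun v hv => hadj v (List.mem_of_head? hv)
    · exact List.disjoint_append_right.2 ⟨fun v hv hvw => hwP v hvw (hTP v hv), hTD⟩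
    · rw [List.head?_append_of_ne_nil _ w.support_ne_nil, List.head?_eq_some_head w.support_ne_nil,
        w.head_support]
      simpa using hT.adj
  have hlen := hP.length_le _ hpath
  rw [← hT.perm.length_eq] at hlen
  simp only [List.length_append, SimpleGraph.Walk.length_support] at hlen
  lia

end ExitSplit

theorem exists_isPath_support_subset {K : ℕ → V}
    (hK : ∀ i, K i = K (i + 1) ∨ G.Adj (K i) (K (i + 1))) {m n : ℕ} (hmn : m ≤ n) :
    ∃ w : G.Walk (K m) (K n), w.IsPath ∧ ∀ v ∈ w.support, ∃ i ∈ Set.Icc m n, K i = v := by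
  classical
  suffices ∃ w : G.Walk (K m) (K n), ∀ v ∈ w.support, ∃ i ∈ Set.Icc m n, K i = v by
    obtain ⟨w, hw⟩ := this
    exact ⟨w.bypass, w.bypass_isPath, fun v hv => hw v (w.support_bypass_subset_support hv)⟩
  induction n, hmn using Nat.le_induction with
  | base => exact ⟨.nil, by simp⟩
  | succ n hmn ih =>
    obtain ⟨w, hw⟩ := ih
    have hw' : ∀ v ∈ w.support, ∃ i ∈ Set.Icc m (n + 1), K i = v := fun v hv =>
      (hw v hv).imp fun i hi => hi.imp_left fun hi => ⟨hi.1, hi.2.trans n.le_succ⟩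
    rcases hK n with heq | hadj
    · exact ⟨w.copy rfl heq, by simpa using hw'⟩
    · refine ⟨w.concat hadj, fun v hv => ?_⟩
      rw [SimpleGraph.Walk.support_concat, List.mem_append, List.mem_singleton] at hv
      exact hv.elim (hw' v) fun hv => ⟨n + 1, ⟨hmn.trans n.le_succ, le_rfl⟩, hv.symm⟩

theorem IsArcModel.false_of_separated {l r : V → ℝ} (h : IsArcModel G l r) {P Q : List V}
    (hP : IsLongestList G P) (hQ : IsLongestList G Q) {K : ℕ → V}
    (hK : ∀ i, K i = K (i + 1) ∨ G.Adj (K i) (K (i + 1))) (hmax : ∀ i, IsMaxArc l r (K i))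
    {b c : ℕ} (hbc : b < c) (hbP : K b ∈ P) (hcQ : K c ∈ Q) (hP' : ∀ i ∈ Set.Ioc b c, K i ∉ P)
    (hQ' : ∀ i ∈ Set.Ico b c, K i ∉ Q) : False := by
  obtain ⟨n, rfl⟩ := Nat.exists_eq_add_one_of_ne_zero hbc.ne_bot
  rw [Nat.lt_succ_iff] at hbc
  have hb_succ : K (b + 1) ∉ P := hP' _ ⟨b.lt_succ_self, Nat.succ_le_succ hbc⟩
  have hn : K n ∉ Q := hQ' _ ⟨hbc, n.lt_succ_self⟩
  obtain ⟨T, C, hTC⟩ := h.exists_isExitSplit hP hbP (hmax _) hb_succ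
    ((hK b).resolve_left fun heq => hb_succ (heq ▸ hbP))
  obtain ⟨U, D, hUD⟩ := h.exists_isExitSplit hQ hcQ (hmax _) hn
    ((hK n).resolve_left fun heq => hn (heq ▸ hcQ)).symm
  have hDC : D.length < C.length := by
    obtain ⟨w, hw, hsupp⟩ := exists_isPath_support_subset hK (Nat.succ_le_succ hbc)
    refine hTC.length_lt hUD h hP hw (fun v hv => ?_) fun v hv hne => ?_
    all_goals obtain ⟨i, ⟨hbi, hin⟩, rfl⟩ := hsupp v hv
    · exact hP' i ⟨hbi, hin⟩
    · exact hQ' i ⟨(Nat.le_succ b).trans hbi, hin.lt_of_ne fun hi => hne (hi ▸ rfl)⟩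
  have hCD : C.length < D.length := by
    obtain ⟨w, hw, hsupp⟩ := exists_isPath_support_subset hK hbc
    refine hUD.length_lt hTC h hQ hw.reverse (fun v hv => ?_) fun v hv hne => ?_
    all_goals
      rw [SimpleGraph.Walk.support_reverse, List.mem_reverse] at hv
      obtain ⟨i, ⟨hbi, hin⟩, rfl⟩ := hsupp v hv
    · exact hQ' i ⟨hbi, Nat.lt_succ_of_le hin⟩
    · exact hP' i ⟨hbi.lt_of_ne fun hi => hne (hi ▸ rfl), hin.trans n.le_succ⟩
  exact hDC.asymm hCD

theorem exists_forall_mem_of_not_separated {ι : Type*} {s : ι → Set ℕ}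
    (hne : ∀ i, (s i).Nonempty) (hbdd : ∀ i, BddAbove (s i))
    (hsep : ∀ i j, ∀ b ∈ s i, ∀ c ∈ s j, b < c → (∀ k ∈ Set.Ioc b c, k ∉ s i) →
      (∀ k ∈ Set.Ico b c, k ∉ s j) → False) : ∃ k, ∀ i, k ∈ s i := by
  rcases isEmpty_or_nonempty ι with _ | _
  · exact ⟨0, isEmptyElim⟩
  let i := Function.argmin fun i => sSup (s i)
  refine ⟨sSup (s i), fun j => by_contra fun hj => ?_⟩
  have hij : sSup (s i) ≤ sSup (s j) := Function.argmin_le (fun i => sSup (s i)) j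
  obtain ⟨c, ⟨hcj, hic⟩, hmin⟩ := WellFounded.has_min (wellFounded_lt (α := ℕ))
    {c | c ∈ s j ∧ sSup (s i) ≤ c} ⟨sSup (s j), Nat.sSup_mem (hne j) (hbdd j), hij⟩
  refine hsep i j _ (Nat.sSup_mem (hne i) (hbdd i)) c hcj
    (hic.lt_of_ne fun heq => hj (heq ▸ hcj)) (fun k hk hki => ?_) fun k hk hkj => ?_
  · exact hk.1.not_ge (le_csSup (hbdd i) hki)
  · exact hmin k ⟨hkj, hk.1⟩ hk.2

theorem exists_walk_forall_mem_support [Finite V] (hG : G.Connected) :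
    ∃ (x y : V) (p : G.Walk x y), ∀ v, v ∈ p.support := by
  classical
  have := Fintype.ofFinite V
  obtain ⟨x⟩ := hG.nonempty
  suffices h : ∀ s : Finset V, ∃ (y : V) (p : G.Walk x y), ∀ v ∈ s, v ∈ p.support by
    obtain ⟨y, p, hp⟩ := h Finset.univ
    exact ⟨x, y, p, fun v => hp v (Finset.mem_univ v)⟩
  intro s
  induction s using Finset.induction_on with
  | empty => exact ⟨x, .nil, by simp⟩
  | insert a s _ ih =>
    obtain ⟨y, p, hp⟩ := ih
    obtain ⟨q⟩ := hG.preconnected y a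
    refine ⟨a, p.append q, Finset.forall_mem_insert _ _ _ |>.2 ⟨?_, fun v hv => ?_⟩⟩
    · exact (p.mem_support_append_iff q).2 (.inr q.end_mem_support)
    · exact (p.mem_support_append_iff q).2 (.inl (hp v hv))

theorem IsArcModel.exists_isMaxArc_seq [Finite V] {l r : V → ℝ} (h : IsArcModel G l r)
    (hG : G.Connected) : ∃ (K : ℕ → V) (N : ℕ), (∀ i, IsMaxArc l r (K i)) ∧
      (∀ i, K i = K (i + 1) ∨ G.Adj (K i) (K (i + 1))) ∧ ∀ v, ∃ i ≤ N, ArcLE l r v (K i) := by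
  obtain ⟨x, y, p, hp⟩ := exists_walk_forall_mem_support hG
  choose top hle hmax using exists_isMaxArc l r
  refine ⟨fun i => top (p.getVert i), p.length, fun i => hmax _, fun i => ?_, fun v => ?_⟩
  · rcases lt_or_ge i p.length with hi | hi
    · have hadj := h.dominates (hle (p.getVert (i + 1))) _ (.inr (p.adj_getVert_succ hi))
      exact (h.dominates (hle (p.getVert i)) _ (hadj.imp Eq.symm .symm)).imp Eq.symm .symm
    · refine .inl (congrArg top ?_)
      rw [p.getVert_of_length_le hi, p.getVert_of_length_le (hi.trans i.le_succ)]
  · obtain ⟨i, rfl, hi⟩ := SimpleGraph.Walk.mem_support_iff_exists_getVert.1 (hp v)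
    exact ⟨i, hi, hle _⟩

theorem IsArcModel.exists_mem_of_isLongestList [Finite V] {l r : V → ℝ} (h : IsArcModel G l r)
    (hG : G.Connected) : ∃ v, ∀ P, IsLongestList G P → v ∈ P := by
  have := hG.nonempty
  obtain ⟨K, N, hmax, hK, hcover⟩ := h.exists_isMaxArc_seq hG
  let hit (P : {P // IsLongestList G P}) : Set ℕ := {i | i ≤ N ∧ K i ∈ P.1}
  have hne : ∀ P, (hit P).Nonempty := by
    rintro ⟨P, hP⟩
    obtain ⟨v, hv⟩ := List.exists_mem_of_ne_nil P hP.ne_nil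
    obtain ⟨i, hi, hvi⟩ := hcover v
    exact ⟨i, hi, hP.mem_of_dominates hv (h.dominates hvi)⟩
  obtain ⟨k, hk⟩ : ∃ k, ∀ P, k ∈ hit P := by
    refine exists_forall_mem_of_not_separated hne (fun P => ⟨N, fun i hi => hi.1⟩) ?_
    rintro ⟨P, hP⟩ ⟨Q, hQ⟩ b ⟨-, hbP⟩ c ⟨hcN, hcQ⟩ hbc hP' hQ'
    exact h.false_of_separated hP hQ hK hmax hbc hbP hcQ
      (fun i hi hiP => hP' i hi ⟨hi.2.trans hcN, hiP⟩)
      fun i hi hiQ => hQ' i hi ⟨hi.2.le.trans hcN, hiQ⟩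
  exact ⟨K k, fun P hP => (hk ⟨P, hP⟩).2⟩

end CircularArc

theorem mainTheorem1 {V : Type*} [Finite V] (G : SimpleGraph V)
    (hconn : G.Connected) (harc : G.IsCircularArcGraph) :
    ∃ v : V, ∀ (x y : V) (p : G.Walk x y), p.IsLongestPath → v ∈ p.support := by
  obtain ⟨l, r, h⟩ := CircularArc.exists_isArcModel harc
  obtain ⟨v, hv⟩ := h.exists_mem_of_isLongestList hconn
  exact ⟨v, fun x y p hp => hv p.support (CircularArc.isLongestList_support hp)⟩
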